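/- Let $A$ be a finite abelian group of odd order, let $\hat A=\mathrm{Hom}(A,U(1))$ and $K=A\times\hat A$, and let $e(k,l)=\chi(y)\lambda(x)^{-1}$ for $k=(x,\chi)$, $l=(y,\lambda)$ in $K$. On $L^2(A)$ let $W_k=T_xM_\chi$, where $T_xf(u)=f(u-x)$ and $M_\chi f(u)=\chi(u)f(u)$, and let $\mathcal W_k=\chi(x/2)W_k$, where $x\mapsto x/2$ is the inverse of multiplication by $2$ on $A$. The Heisenberg group $G$ consists of the unitary operators $zW_k$ with $z\in U(1)$, $k\in K$. Let $\mathrm{Aut}(K,e)$ be the group of automorphisms of $K$ preserving $e$; it acts on $G$ by the automorphisms $\sigma(\alpha): z\mathcal W_k\mapsto z\mathcal W_{\alpha(k)}$, which fix the centre of $G$. The Weil representation of $\mathrm{Aut}(K,e)$ is the projective representation on $L^2(A)$ that sends $\alpha$ to the unitary operator $W(\sigma(\alpha))$, unique up to a unitary scalar, such that $W(\sigma(\alpha))\,g=\sigma(\alpha)(g)\,W(\sigma(\alpha))$ for all $g\in G$. A subspace is called irreducible if it is invariant and non-zero, and contains no invariant subspaces other than $0$ and itself. Then the following hold. 1. The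 subspace of even functions and the subspace of odd functions in $L^2(A)$ are invariant under the Weil representation of $\mathrm{Aut}(K,e)$. 2. If $A\neq 0$, then $L^2(A)$ is not irreducible under the Weil representation of $\mathrm{Aut}(K,e)$. 3. The subspaces of even and of odd functions are both irreducible if and only if the exponent of $A$ is a prime number. -/

import Mathlib

set_option linter.unusedSectionVars false

noncomputable section

namespace FiniteWeil

variable (A : Type*) [AddCommGroup A] [Fintype A]

/-- The Hilbert space of complex functions on `A`, with the norm `(∑ ‖f u‖ ^ 2) ^ (1 / 2)`. -/
abbrev L2 : Type _ := EuclideanSpace ℂ A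

/-- The group `K = A × Â`, where `Â` is the group of homomorphisms from `A` to the unit circle. -/
abbrev K : Type _ := A × AddChar A Circle

/-- The group of unitary operators on `L2 A`. -/
abbrev U : Type _ := L2 A ≃ₗᵢ[ℂ] L2 A

variable {A}

/-! ### Weyl operators and the Heisenberg group -/

/-- The translation operator `(T_x f)(u) = f (u - x)`. -/
def translation (x : A) : U A :=
  LinearIsometryEquiv.piLpCongrLeft 2 ℂ ℂ (Equiv.addRight x)

/-- Pointwise multiplication by a function with values in the unit circle. -/
def phase (z : A → Circle) : U A where
  toFun f := WithLp.toLp 2 fun u => (z u : ℂ) * f u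
  invFun f := WithLp.toLp 2 fun u => ((z u)⁻¹ : ℂ) * f u
  map_add' f g := by ext u; simp [mul_add]
  map_smul' c f := by ext u; simp [mul_left_comm]
  left_inv f := by ext u; simp
  right_inv f := by ext u; simp
  norm_map' f := by simp [EuclideanSpace.norm_eq, Circle.norm_coe]

/-- The modulation operator `(M_χ f)(u) = χ u * f u`. -/
def modulation (χ : AddChar A Circle) : U A := phase χ

/-- The Weyl operator `W_k = T_x M_χ` for `k = (x, χ)`. -/
def weyl (k : K A) : U A := translation k.1 * modulation k.2

/-- The operator of multiplication by a scalar `z` of absolute value one. -/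
def scalarOp (z : Circle) : U A := phase fun _ => z

theorem translation_apply (x : A) (f : L2 A) (u : A) : translation x f u = f (u - x) := by
  simp [translation, LinearIsometryEquiv.piLpCongrLeft_apply, sub_eq_add_neg]

theorem phase_apply (z : A → Circle) (f : L2 A) (u : A) : phase z f u = z u * f u := rfl

theorem weyl_apply (k : K A) (f : L2 A) (u : A) :
    weyl k f u = k.2 (u - k.1) * f (u - k.1) := by
  simp [weyl, modulation, translation_apply, phase_apply]

theorem scalarOp_apply (z : Circle) (f : L2 A) : scalarOp z f = (z : ℂ) • f := rfl

theorem scalarOp_mul (z w : Circle) : (scalarOp (z * w) : U A) = scalarOp z * scalarOp w := by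
  ext f u
  simp only [LinearIsometryEquiv.coe_mul, Function.comp, scalarOp_apply, Circle.coe_mul, mul_smul]

theorem scalarOp_one : (scalarOp 1 : U A) = 1 := by
  ext f u; simp [scalarOp_apply]

theorem scalarOp_comm (z : Circle) (T : U A) : T * scalarOp z = scalarOp z * T := by
  ext f u; simp [scalarOp_apply]

theorem weyl_zero : (weyl 0 : U A) = 1 := by
  ext f u; simp [weyl_apply]

theorem weyl_mul (k l : K A) : weyl k * weyl l = scalarOp (k.2 l.1) * weyl (k + l) := by
  ext f u
  simp only [LinearIsometryEquiv.coe_mul, Function.comp, scalarOp_apply, PiLp.smul_apply,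
    weyl_apply, Prod.fst_add, Prod.snd_add, AddChar.add_apply, smul_eq_mul]
  have h : u - k.1 = l.1 + (u - (k.1 + l.1)) := by abel
  rw [h, AddChar.map_add_eq_mul]
  simp only [add_sub_cancel_left, Circle.coe_mul]
  ring

theorem scalarOp_weyl_mul (z w : Circle) (k l : K A) :
    scalarOp z * weyl k * (scalarOp w * weyl l) = scalarOp (z * w * k.2 l.1) * weyl (k + l) := by
  rw [scalarOp_mul, scalarOp_mul, mul_assoc _ (scalarOp (k.2 l.1)), ← weyl_mul,
    mul_assoc, ← mul_assoc (weyl k), scalarOp_comm]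
  simp only [mul_assoc]

variable (A) in
/-- The Heisenberg group: all operators `z W_k` with `z` in the unit circle and `k` in `K`. -/
def Heisenberg : Subgroup (U A) where
  carrier := {T | ∃ (z : Circle) (k : K A), T = scalarOp z * weyl k}
  one_mem' := ⟨1, 0, by simp [weyl_zero, scalarOp_one]⟩
  mul_mem' := by
    rintro _ _ ⟨z, k, rfl⟩ ⟨w, l, rfl⟩
    exact ⟨_, _, scalarOp_weyl_mul z w k l⟩
  inv_mem' := by
    rintro _ ⟨z, k, rfl⟩
    refine ⟨z⁻¹ * k.2 k.1, -k, ?_⟩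
    rw [inv_eq_iff_mul_eq_one, scalarOp_weyl_mul]
    simp [weyl_zero, scalarOp_one, AddChar.map_neg_eq_inv]

theorem scalarOp_mem (z : Circle) : scalarOp z ∈ Heisenberg A := ⟨z, 0, by simp [weyl_zero]⟩

theorem weyl_mem (k : K A) : weyl k ∈ Heisenberg A := ⟨1, k, by simp [scalarOp_one]⟩

/-- The inclusion `j` of the unit circle into the Heisenberg group; its image is the centre. -/
def j (z : Circle) : Heisenberg A := ⟨scalarOp z, scalarOp_mem z⟩

variable (A) in
/-- The group `B₀(G)` of automorphisms of the Heisenberg group that fix its centre pointwise. -/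
def B0 : Subgroup (MulAut (Heisenberg A)) where
  carrier := {σ | ∀ z, σ (j z) = j z}
  one_mem' _ := rfl
  mul_mem' {σ τ} hσ hτ z := by
    rw [MulAut.mul_apply, hτ z, hσ z]
  inv_mem' {σ} hσ z := by
    rw [MulAut.inv_apply, MulEquiv.symm_apply_eq, hσ z]

/-! ### The bicharacter `e` and the group `Aut(K, e)` -/

/-- `e(k, l) = χ y * (ψ x)⁻¹` for `k = (x, χ)` and `l = (y, ψ)`. -/
def e (k l : K A) : Circle := k.2 l.1 * (l.2 k.1)⁻¹

variable (A) in
/-- The group of automorphisms of `K` that preserve `e`.  Mathlib writes the group of automorphisms of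
an additive group additively, with composition as the addition. -/
def AutKE : AddSubgroup (AddAut (K A)) where
  carrier := {α | ∀ k l, e (α k) (α l) = e k l}
  zero_mem' _ _ := rfl
  add_mem' {α β} hα hβ k l := by
    rw [AddAut.add_apply, AddAut.add_apply, hα, hβ]
  neg_mem' {α} hα k l := by
    rw [← hα]; simp

/-! ### Normalised Weyl operators and the embedding of `Aut(K, e)` in `B₀(G)` -/

/-- Division by two: when the order of `A` is odd, this is the inverse of multiplication by two
(see `two_nsmul_half`). -/
def half (x : A) : A := ((Fintype.card A + 1) / 2) • x

theorem two_nsmul_half (hA : Odd (Fintype.card A)) (x : A) : 2 • half x = x := by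
  obtain ⟨m, hm⟩ := hA
  have h : 2 * ((Fintype.card A + 1) / 2) = Fintype.card A + 1 := by omega
  rw [half, ← mul_nsmul', h, add_nsmul, card_nsmul_eq_zero, zero_add, one_nsmul]

/-- The normalised Weyl operator `χ(x / 2) W_k` for `k = (x, χ)`. -/
def normWeyl (k : K A) : U A := scalarOp (k.2 (half k.1)) * weyl k

theorem e_pow_half (k l : K A) :
    e k l ^ ((Fintype.card A + 1) / 2) = k.2 (half l.1) * (l.2 (half k.1))⁻¹ := by
  simp [e, half, mul_pow, AddChar.map_nsmul_eq_pow]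

theorem normWeyl_mul (hA : Odd (Fintype.card A)) (k l : K A) :
    normWeyl k * normWeyl l =
      scalarOp (e k l ^ ((Fintype.card A + 1) / 2)) * normWeyl (k + l) := by
  have h : k.2 l.1 = k.2 (half l.1) * k.2 (half l.1) := by
    rw [← AddChar.map_add_eq_mul, ← two_nsmul, two_nsmul_half hA]
  have h' : half (k.1 + l.1) = half k.1 + half l.1 := nsmul_add _ _ _
  rw [normWeyl, normWeyl, scalarOp_weyl_mul, normWeyl, ← mul_assoc, ← scalarOp_mul, e_pow_half]
  congr 2
  rw [h, Prod.fst_add, h', Prod.snd_add, AddChar.add_apply, AddChar.map_add_eq_mul,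
    AddChar.map_add_eq_mul, eq_comm, ← mul_inv_eq_one]
  simp only [mul_inv]
  generalize k.2 (half l.1) = a, l.2 (half k.1) = b, k.2 (half k.1) = c, l.2 (half l.1) = d
  rw [show a * b⁻¹ * (c * a * (b * d)) * (c⁻¹ * d⁻¹ * (a⁻¹ * a⁻¹)) =
    (a * a⁻¹) * (a * a⁻¹) * (b * b⁻¹) * (c * c⁻¹) * (d * d⁻¹) by
      simp only [mul_comm, mul_assoc, mul_left_comm]]
  simp

theorem eq_of_weyl_eq {x y : A} {χ ψ : AddChar A Circle} {z : Circle}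
    (h : (weyl (x, χ) : U A) = scalarOp z * weyl (y, ψ)) : x = y ∧ χ = ψ ∧ z = 1 := by
  classical
  have key : ∀ f : L2 A, ∀ u, (χ (u - x) : ℂ) * f (u - x) = z * (ψ (u - y) * f (u - y)) := by
    intro f u
    have := congrArg (fun T : U A => T f u) h
    simpa [weyl_apply, scalarOp_apply] using this
  have hxy : x = y := by
    by_contra hne
    have := key (EuclideanSpace.single 0 1) x
    simp [sub_eq_zero, hne] at this
  subst hxy
  have key' : ∀ v, (χ v : ℂ) = z * ψ v := by
    intro v
    have := key (WithLp.toLp 2 fun _ => 1) (v + x)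
    simpa using this
  have hz : z = 1 := by
    have := key' 0
    simp at this
    exact Circle.ext (by simpa using this.symm)
  subst hz
  refine ⟨rfl, ?_, rfl⟩
  ext v
  simpa using key' v

/-- Each element of the Heisenberg group is `z • 𝒲_k` for a unique pair `(z, k)`, where `𝒲_k` is
the normalised Weyl operator. -/
def heisenbergEquiv : Circle × K A ≃ Heisenberg A :=
  Equiv.ofBijective
    (fun p => ⟨scalarOp p.1 * normWeyl p.2,
      mul_mem (scalarOp_mem _) (mul_mem (scalarOp_mem _) (weyl_mem _))⟩) (by
    constructor
    · rintro ⟨z, x, χ⟩ ⟨w, y, ψ⟩ h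
      have h' := congrArg Subtype.val h
      simp only [normWeyl, ← mul_assoc, ← scalarOp_mul] at h'
      set a := z * χ (half x) with ha
      set b := w * ψ (half y) with hb
      have h2 : (weyl (x, χ) : U A) = scalarOp (a⁻¹ * b) * weyl (y, ψ) := by
        rw [scalarOp_mul, mul_assoc, ← h', ← mul_assoc, ← scalarOp_mul]
        simp [scalarOp_one]
      obtain ⟨rfl, rfl, h3⟩ := eq_of_weyl_eq h2
      rw [inv_mul_eq_one, ha, hb] at h3
      rw [mul_right_cancel h3]
    · rintro ⟨_, z, k, rfl⟩
      refine ⟨(z * (k.2 (half k.1))⁻¹, k), Subtype.ext ?_⟩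
      simp [normWeyl, ← mul_assoc, ← scalarOp_mul])

theorem coe_heisenbergEquiv (z : Circle) (k : K A) :
    (heisenbergEquiv (z, k) : U A) = scalarOp z * normWeyl k := rfl

theorem heisenbergEquiv_mul (hA : Odd (Fintype.card A)) (z w : Circle) (k l : K A) :
    heisenbergEquiv (z, k) * heisenbergEquiv (w, l) =
      heisenbergEquiv (z * w * e k l ^ ((Fintype.card A + 1) / 2), k + l) := by
  apply Subtype.ext
  rw [Subgroup.coe_mul, coe_heisenbergEquiv, coe_heisenbergEquiv, coe_heisenbergEquiv,
    scalarOp_mul, scalarOp_mul, mul_assoc _ (scalarOp (e k l ^ _)), ← normWeyl_mul hA, mul_assoc,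
    ← mul_assoc (normWeyl k), scalarOp_comm]
  simp only [mul_assoc]

/-- The automorphism `z 𝒲_k ↦ z 𝒲_{α k}` of the Heisenberg group. -/
def sectionEquiv (hA : Odd (Fintype.card A)) (α : AutKE A) : MulAut (Heisenberg A) where
  toEquiv := heisenbergEquiv.symm.trans
    (((Equiv.refl Circle).prodCongr α.1.toEquiv).trans heisenbergEquiv)
  map_mul' g h := by
    obtain ⟨⟨z, k⟩, rfl⟩ := heisenbergEquiv.surjective g
    obtain ⟨⟨w, l⟩, rfl⟩ := heisenbergEquiv.surjective h
    have hα := α.2 k l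
    simp only [heisenbergEquiv_mul hA, Equiv.toFun_as_coe, Equiv.trans_apply,
      Equiv.symm_apply_apply, Equiv.prodCongr_apply, Prod.map, Equiv.refl_apply]
    simp only [AddEquiv.toEquiv_eq_coe, EquivLike.coe_coe, map_add, hα]

theorem sectionEquiv_apply (hA : Odd (Fintype.card A)) (α : AutKE A) (z : Circle) (k : K A) :
    sectionEquiv hA α (heisenbergEquiv (z, k)) = heisenbergEquiv (z, α.1 k) := by
  change heisenbergEquiv _ = _
  simp

theorem heisenbergEquiv_zero (z : Circle) : heisenbergEquiv (z, (0 : K A)) = j z := by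
  apply Subtype.ext
  simp [coe_heisenbergEquiv, normWeyl, weyl_zero, j, scalarOp_one]

/-- The section `α ↦ (𝒲_k ↦ 𝒲_{α k})`, through which `Aut(K, e)` is regarded as a subgroup of
`B₀(G)` when the order of `A` is odd. -/
def autSection (hA : Odd (Fintype.card A)) : Multiplicative (AutKE A) →* B0 A where
  toFun α := ⟨sectionEquiv hA α.toAdd, fun z => by
    rw [← heisenbergEquiv_zero, sectionEquiv_apply, map_zero]⟩
  map_one' := by
    apply Subtype.ext; apply MulEquiv.ext; intro g
    obtain ⟨⟨z, k⟩, rfl⟩ := heisenbergEquiv.surjective g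
    exact sectionEquiv_apply hA 0 z k
  map_mul' α β := by
    apply Subtype.ext; apply MulEquiv.ext; intro g
    obtain ⟨⟨z, k⟩, rfl⟩ := heisenbergEquiv.surjective g
    change sectionEquiv hA _ _ = sectionEquiv hA α.toAdd (sectionEquiv hA β.toAdd _)
    simp only [sectionEquiv_apply]
    rfl

theorem autSection_normWeyl (hA : Odd (Fintype.card A)) (α : AutKE A) (k : K A) :
    ((autSection hA (.ofAdd α)).1 (heisenbergEquiv (1, k)) : U A) = normWeyl (α.1 k) := by
  change ((sectionEquiv hA α _ : Heisenberg A) : U A) = _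
  rw [sectionEquiv_apply, coe_heisenbergEquiv, scalarOp_one, one_mul]

/-! ### The operators of the Weil representation -/

/-- `T` intertwines the tautological representation of the Heisenberg group with its twist by
`σ`, that is, `T g = σ(g) T` for all `g`. -/
def IsIntertwiner (σ : B0 A) (T : U A) : Prop :=
  ∀ g : Heisenberg A, T * (g : U A) = (σ.1 g : U A) * T

theorem weyl_delta (k : K A) [DecidableEq A] (u : A) :
    weyl k (EuclideanSpace.single u (1 : ℂ)) =
      (k.2 u : ℂ) • EuclideanSpace.single (u + k.1) (1 : ℂ) := by
  ext v
  by_cases h : v = u + k.1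
  · subst h; simp [weyl_apply]
  · have h' : v - k.1 ≠ u := fun h2 => h (by rw [← h2]; abel)
    simp [weyl_apply, h, h']

/-- An operator that commutes with all Weyl operators is a scalar. -/
theorem exists_eq_smul_of_commute (L : L2 A →ₗ[ℂ] L2 A)
    (hL : ∀ (k : K A) (f : L2 A), L (weyl k f) = weyl k (L f)) : ∃ c : ℂ, ∀ f, L f = c • f := by
  classical
  set δ : A → L2 A := fun u => EuclideanSpace.single u (1 : ℂ) with hδ
  have h0 : L (δ 0) = (L (δ 0) 0) • δ 0 := by
    ext v
    by_cases hv : v = 0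
    · subst hv; simp [hδ]
    · obtain ⟨χ, hχ⟩ := AddChar.exists_apply_ne_zero.2 hv
      have h1 := congrArg (fun f : L2 A => f v) (hL (0, AddChar.circleEquivComplex.symm χ) (δ 0))
      simp only [hδ, weyl_delta] at h1
      simp only [weyl_apply] at h1
      have h2 : ((AddChar.circleEquivComplex.symm χ) v : ℂ) = χ v := by
        conv_rhs => rw [← AddChar.circleEquivComplex.apply_symm_apply χ]
        rfl
      simp [h2] at h1
      simp [hδ, hv]
      by_contra hne
      exact hχ ((mul_eq_right₀ hne).1 h1.symm)
  refine ⟨L (δ 0) 0, fun f => ?_⟩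
  suffices h : L = (L (δ 0) 0) • LinearMap.id by
    conv_lhs => rw [h]
    simp
  apply (EuclideanSpace.basisFun A ℂ).toBasis.ext
  intro u
  have hu : δ u = weyl (u, 0) (δ 0) := by simp [hδ, weyl_delta]
  have : (EuclideanSpace.basisFun A ℂ).toBasis u = δ u := by simp [hδ]
  rw [this, hu, hL]
  conv_lhs => rw [h0]
  simp

theorem finite_dual : Finite (AddChar A Circle) :=
  Finite.of_injective _ AddChar.circleEquivComplex.injective

theorem exists_isIntertwiner (σ : B0 A) : ∃ T : U A, IsIntertwiner σ T := by
  classical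
  have := finite_dual (A := A)
  let _ : Fintype (AddChar A Circle) := Fintype.ofFinite _
  -- the twisted Weyl operators
  let Φ : K A → U A := fun k => (σ.1 ⟨weyl k, weyl_mem k⟩ : U A)
  have hΦ : ∀ k l, Φ (k + l) = scalarOp (k.2 l.1)⁻¹ * (Φ k * Φ l) := by
    intro k l
    have h1 : (⟨weyl (k + l), weyl_mem _⟩ : Heisenberg A) =
        j (k.2 l.1)⁻¹ * (⟨weyl k, weyl_mem k⟩ * ⟨weyl l, weyl_mem l⟩) := by
      apply Subtype.ext
      change weyl (k + l) = scalarOp _ * (weyl k * weyl l)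
      rw [weyl_mul, ← mul_assoc, ← scalarOp_mul]
      simp [scalarOp_one]
    change ((σ.1 _ : Heisenberg A) : U A) = _
    rw [h1, map_mul, map_mul, σ.2]
    rfl
  have hΦ0 : Φ 0 = 1 := by
    have h1 : (⟨weyl 0, weyl_mem 0⟩ : Heisenberg A) = 1 := Subtype.ext weyl_zero
    change ((σ.1 _ : Heisenberg A) : U A) = _
    rw [h1, map_one]; rfl
  let T : L2 A → L2 A → L2 A →ₗ[ℂ] L2 A := fun v w =>
    ∑ k : K A, ((innerSL ℂ (weyl k w)).toLinearMap).smulRight (Φ k v)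
  have hT : ∀ v w f, T v w f = ∑ k : K A, inner ℂ (weyl k w) f • Φ k v := by
    intro v w f
    simp [T, LinearMap.sum_apply]
  have hcomm : ∀ v w l f, T v w (weyl l f) = Φ l (T v w f) := by
    intro v w l f
    rw [hT, hT, map_sum, ← Equiv.sum_comp (Equiv.addLeft l)]
    refine Finset.sum_congr rfl fun k _ => ?_
    have h1 : (weyl (l + k) : U A) = scalarOp (l.2 k.1)⁻¹ * (weyl l * weyl k) := by
      rw [weyl_mul, ← mul_assoc, ← scalarOp_mul]
      simp [scalarOp_one]
    simp only [Equiv.coe_addLeft, h1, hΦ, LinearIsometryEquiv.coe_mul, Function.comp,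
      scalarOp_apply, inner_smul_left, LinearIsometryEquiv.inner_map_map, map_smul, smul_smul]
    congr 1
    have h2 : ((l.2 k.1 : Circle) : ℂ) ≠ 0 := Circle.coe_ne_zero _
    simp only [← Circle.coe_inv_eq_conj, inv_inv]
    simp only [Circle.coe_inv]
    field_simp
  -- some `T v w` is non-zero
  have hne : ∃ v w f, T v w f ≠ 0 := by
    by_contra! h
    let v : L2 A := EuclideanSpace.single 0 1
    have h1 : ∑ u : A, T v (EuclideanSpace.single u 1) (EuclideanSpace.single u 1) = 0 := by
      simp [h]
    simp only [hT] at h1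
    rw [Finset.sum_comm] at h1
    simp only [← Finset.sum_smul] at h1
    have h2 : ∀ k : K A, k ≠ 0 → ∑ u : A, inner ℂ (weyl k (EuclideanSpace.single u (1 : ℂ)))
        (EuclideanSpace.single u (1 : ℂ)) = 0 := by
      rintro ⟨x, χ⟩ hk
      by_cases hx : x = 0
      · subst hx
        have hχ : AddChar.circleEquivComplex χ ≠ 0 := by
          intro h3
          rw [map_eq_zero_iff _ AddChar.circleEquivComplex.injective] at h3
          exact hk (by simp [h3])
        have h4 := AddChar.sum_eq_zero_iff_ne_zero.2 hχ
        have h5 := congrArg (starRingEnd ℂ) h4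
        rw [map_sum, map_zero] at h5
        rw [← h5]
        refine Finset.sum_congr rfl fun u _ => ?_
        simp only [weyl_delta, inner_smul_left, add_zero, inner_self_eq_norm_sq_to_K]
        simp
        rfl
      · refine Finset.sum_eq_zero fun u _ => ?_
        rw [weyl_delta, inner_smul_left, EuclideanSpace.inner_single_left]
        simp [hx]
    rw [Finset.sum_eq_single 0 (fun k _ hk => by rw [h2 k hk, zero_smul]) (by simp)] at h1
    simp [weyl_zero, hΦ0, v] at h1
  obtain ⟨v, w, f₀, hf₀⟩ := hne
  set S := T v w with hS
  -- `S* S` is a scalar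
  obtain ⟨c, hc⟩ := exists_eq_smul_of_commute (LinearMap.adjoint S ∘ₗ S) (by
    intro k f
    apply ext_inner_right ℂ
    intro g
    obtain ⟨g, rfl⟩ := (weyl k).surjective g
    rw [LinearIsometryEquiv.inner_map_map, LinearMap.comp_apply, LinearMap.comp_apply,
      LinearMap.adjoint_inner_left, LinearMap.adjoint_inner_left, hcomm, hcomm,
      LinearIsometryEquiv.inner_map_map])
  have hnorm : ∀ f, ‖S f‖ ^ 2 = c.re * ‖f‖ ^ 2 := by
    intro f
    have h1 : inner ℂ ((LinearMap.adjoint S ∘ₗ S) f) f = inner ℂ (S f) (S f) := by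
      rw [LinearMap.comp_apply, LinearMap.adjoint_inner_left]
    rw [hc, inner_smul_left, inner_self_eq_norm_sq_to_K, inner_self_eq_norm_sq_to_K] at h1
    have h2 := congrArg Complex.re h1
    have h3 : ∀ r : ℝ, ((r : ℂ) ^ 2) = ((r ^ 2 : ℝ) : ℂ) := by intro r; push_cast; rfl
    simp only [Complex.coe_algebraMap, h3, Complex.mul_re, Complex.ofReal_re, Complex.ofReal_im,
      mul_zero, sub_zero, Complex.conj_re] at h2
    exact h2.symm
  have hcpos : 0 < c.re := by
    have h1 : 0 < ‖S f₀‖ ^ 2 := by positivity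
    rw [hnorm] at h1
    exact pos_of_mul_pos_left h1 (by positivity)
  let R : L2 A →ₗᵢ[ℂ] L2 A :=
    { toLinearMap := ((√c.re)⁻¹ : ℂ) • S
      norm_map' := fun f => by
        rw [LinearMap.smul_apply, norm_smul]
        have h1 : ‖S f‖ = √c.re * ‖f‖ := by
          rw [← Real.sqrt_sq (norm_nonneg (S f)), hnorm, Real.sqrt_mul hcpos.le,
            Real.sqrt_sq (norm_nonneg f)]
        have h2 : 0 < √c.re := Real.sqrt_pos.2 hcpos
        rw [h1, norm_inv, Complex.norm_real, Real.norm_of_nonneg h2.le]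
        field_simp }
  refine ⟨R.toLinearIsometryEquiv rfl, ?_⟩
  rintro ⟨_, z, k, rfl⟩
  have h1 : (⟨scalarOp z * weyl k, z, k, rfl⟩ : Heisenberg A) = j z * ⟨weyl k, weyl_mem k⟩ := rfl
  have h2 : ((σ.1 ⟨scalarOp z * weyl k, z, k, rfl⟩ : Heisenberg A) : U A) =
      scalarOp z * Φ k := by
    rw [h1, map_mul, σ.2]; rfl
  rw [h2, ← mul_assoc, scalarOp_comm, mul_assoc, mul_assoc]
  congr 1
  apply LinearIsometryEquiv.ext
  intro f
  change ((√c.re)⁻¹ : ℂ) • S (weyl k f) = Φ k (((√c.re)⁻¹ : ℂ) • S f)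
  rw [hcomm, map_smul]

/-- The unitary operator `W(σ)` of the Weil representation: a unitary operator with
`W(σ) g = σ(g) W(σ)` for all `g` in the Heisenberg group.  It is unique up to a scalar of absolute
value one (see `IsIntertwiner.eq_scalar`), and such a scalar does not affect invariant subspaces. -/
def weil (σ : B0 A) : U A := (exists_isIntertwiner σ).choose

theorem weil_spec (σ : B0 A) : IsIntertwiner σ (weil σ) := (exists_isIntertwiner σ).choose_spec

theorem IsIntertwiner.eq_scalar {σ : B0 A} {S T : U A} (hS : IsIntertwiner σ S)
    (hT : IsIntertwiner σ T) : ∃ z : Circle, S = scalarOp z * T := by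
  classical
  obtain ⟨c, hc⟩ := exists_eq_smul_of_commute
    (((T⁻¹ * S : U A).toLinearEquiv : L2 A →ₗ[ℂ] L2 A)) (by
    intro k f
    have h1 : (T⁻¹ * S) * weyl k = weyl k * (T⁻¹ * S) := by
      have hSk := hS ⟨weyl k, weyl_mem k⟩
      have hTk := hT ⟨weyl k, weyl_mem k⟩
      simp only at hSk hTk
      rw [mul_assoc, hSk, ← mul_assoc, ← mul_assoc]
      congr 1
      rw [inv_mul_eq_iff_eq_mul, ← mul_assoc, hTk, mul_assoc, mul_inv_cancel, mul_one]
    exact congrArg (fun R : U A => R f) h1)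
  have hc' : ∀ f, (T⁻¹ * S) f = c • f := hc
  have hnorm : ‖c‖ = 1 := by
    have h1 := congrArg norm (hc' (EuclideanSpace.single 0 1))
    rw [LinearIsometryEquiv.norm_map, norm_smul] at h1
    simpa using h1.symm
  have hmem : c ∈ Submonoid.unitSphere ℂ := mem_sphere_zero_iff_norm.2 hnorm
  obtain ⟨z, hz⟩ : ∃ z : Circle, (z : ℂ) = c := ⟨⟨c, hmem⟩, rfl⟩
  refine ⟨z, ?_⟩
  rw [← scalarOp_comm z T, ← inv_mul_eq_iff_eq_mul]
  apply LinearIsometryEquiv.ext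
  intro f
  rw [hc', scalarOp_apply, hz]

/-! ### Invariant and irreducible subspaces for the Weil representation of `Aut(K, e)` -/

/-- `V` is invariant under `W(σ)` for all `σ` in `Aut(K, e)`. -/
def WeilInvariant (hA : Odd (Fintype.card A)) (V : Submodule ℂ (L2 A)) : Prop :=
  ∀ α : AutKE A, ∀ f ∈ V, weil (autSection hA (.ofAdd α)) f ∈ V

/-- `V` is an irreducible subspace for the Weil representation of `Aut(K, e)`: it is invariant and
non-zero, and its only invariant subspaces are `0` and `V`. -/
def WeilIrreducible (hA : Odd (Fintype.card A)) (V : Submodule ℂ (L2 A)) : Prop :=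
  WeilInvariant hA V ∧ V ≠ ⊥ ∧
    ∀ V' : Submodule ℂ (L2 A), V' ≤ V → WeilInvariant hA V' → V' = ⊥ ∨ V' = V

variable (A) in
/-- The subspace of even functions. -/
def evenFunctions : Submodule ℂ (L2 A) where
  carrier := {f | ∀ u, f (-u) = f u}
  zero_mem' _ := rfl
  add_mem' hf hg u := by simp [hf u, hg u]
  smul_mem' c f hf u := by simp [hf u]

variable (A) in
/-- The subspace of odd functions. -/
def oddFunctions : Submodule ℂ (L2 A) where
  carrier := {f | ∀ u, f (-u) = -f u}
  zero_mem' u := by simp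
  add_mem' hf hg u := by simp [hf u, hg u, add_comm]
  smul_mem' c f hf u := by simp [hf u]

end FiniteWeil

end

noncomputable section

namespace FiniteWeil

variable {A : Type*} [AddCommGroup A] [Fintype A]

/-! The normalised Weyl operators form a basis of `End(L²(A))` indexed by `K`, and conjugation by
the Weil operator of `α` permutes this basis through `α`. So an operator commutes with the Weil
representation exactly when its coefficient function on `K` is constant on orbits of `Aut(K, e)`
(`commutesWithWeil_sum_iff`). The constant function 1 gives `|A|` times the reflection `f(u) ↦
f(-u)` (`sum_normWeylEnd_apply`), hence the even and odd functions are invariant.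

If `A` has prime exponent, symplectic transvections show that `Aut(K, e)` is transitive on `K \ {0}`
(`exists_autKE_apply_eq`). The commutant is then spanned by the identity and the reflection, which
are scalar on even and on odd functions; orthogonal projections onto invariant subspaces lie in the
commutant, so both spaces are irreducible. Conversely, if both are irreducible, Schur's lemma puts
every invariant-coefficient operator in that same span, so an invariant function on `K` is constant
off 0 (`eq_of_weilIrreducible`). For the indicator of `p`-torsion, with `p` a prime divisor of
`|A|`, this forces `pA = 0`. -/

/-! ### Normalised Weyl operators as a basis of the endomorphism algebra. -/

instance : Fintype (AddChar A Circle) := @Fintype.ofFinite _ finite_dual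

theorem card_dual : Fintype.card (AddChar A Circle) = Fintype.card A := by
  rw [← AddChar.card_eq (α := A)]
  exact Fintype.card_congr AddChar.circleEquivComplex.toEquiv

theorem circleEquivComplex_apply (χ : AddChar A Circle) (v : A) :
    AddChar.circleEquivComplex χ v = χ v := rfl

theorem half_neg (x : A) : half (-x) = -half x := smul_neg _ _

theorem half_add (x y : A) : half (x + y) = half x + half y := nsmul_add _ _ _

/-- The normalised Weyl operator as an element of the algebra of endomorphisms of `L2 A`. -/
def normWeylEnd (k : K A) : Module.End ℂ (L2 A) :=
  ((normWeyl k : U A).toLinearEquiv : L2 A →ₗ[ℂ] L2 A)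

theorem normWeylEnd_apply (k : K A) (f : L2 A) : normWeylEnd k f = normWeyl k f := rfl

theorem normWeyl_apply (k : K A) (f : L2 A) (u : A) :
    normWeyl k f u = k.2 (half k.1) * (k.2 (u - k.1) * f (u - k.1)) := by
  simp [normWeyl, scalarOp_apply, weyl_apply]

theorem normWeyl_zero : (normWeyl 0 : U A) = 1 := by
  simp [normWeyl, weyl_zero, scalarOp_one]

/-- Applied to the point mass at `v` and evaluated at `v + x`, only the operators with translation
part `x` survive; what remains is a linear relation between characters, which is trivial. -/
theorem linearIndependent_normWeylEnd :
    LinearIndependent ℂ (normWeylEnd : K A → Module.End ℂ (L2 A)) := by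
  classical
  rw [Fintype.linearIndependent_iff]
  rintro c hc ⟨x, χ⟩
  have key : ∀ v : A, ∑ ψ : AddChar A Circle, c (x, ψ) * ψ (half x) * ψ v = 0 := by
    intro v
    have h := congrArg (fun L : Module.End ℂ (L2 A) => L (EuclideanSpace.single v 1) (v + x)) hc
    simp only [LinearMap.sum_apply, LinearMap.smul_apply, normWeylEnd_apply, WithLp.ofLp_sum,
      Finset.sum_apply, PiLp.smul_apply, normWeyl_apply, LinearMap.zero_apply, PiLp.zero_apply,
      Fintype.sum_prod_type] at h
    rw [Finset.sum_eq_single x] at h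
    · simpa [mul_assoc] using h
    · intro y _ hy
      refine Finset.sum_eq_zero fun ψ _ => ?_
      have h1 : v + x - y ≠ v := by
        intro h2
        exact hy (by rw [add_sub_assoc, add_eq_left, sub_eq_zero] at h2; exact h2.symm)
      simp [h1]
    · simp
  have h1 := Fintype.linearIndependent_iff.1
    ((AddChar.linearIndependent A ℂ).comp _ (AddChar.circleEquivComplex (α := A)).injective)
    (fun ψ => c (x, ψ) * ψ (half x)) (by
      ext v
      simpa [circleEquivComplex_apply] using key v) χ
  simpa using h1

/-- Independence suffices for spanning, because `|K| = |A|² = dim End(L²(A))`. -/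
theorem exists_eq_sum_normWeylEnd (X : Module.End ℂ (L2 A)) :
    ∃ c : K A → ℂ, X = ∑ k, c k • normWeylEnd k := by
  have h := (linearIndependent_normWeylEnd (A := A)).span_eq_top_of_card_eq_finrank' (by
    rw [Fintype.card_prod, card_dual, Module.finrank_linearMap, finrank_euclideanSpace])
  have hX : X ∈ Submodule.span ℂ (Set.range (normWeylEnd : K A → Module.End ℂ (L2 A))) := by
    rw [h]; trivial
  obtain ⟨c, hc⟩ := (Submodule.mem_span_range_iff_exists_fun ℂ).1 hX
  exact ⟨c, hc.symm⟩

/-- For fixed `x`, orthogonality of characters makes the sum over `χ` of `χ(x/2 + u - x)` vanish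
unless `x = 2u`, and then `u - x = -u`. -/
theorem sum_normWeylEnd_apply (hA : Odd (Fintype.card A)) (f : L2 A) (u : A) :
    (∑ k : K A, normWeylEnd k) f u = Fintype.card A * f (-u) := by
  classical
  simp only [LinearMap.sum_apply, normWeylEnd_apply, WithLp.ofLp_sum, Finset.sum_apply,
    normWeyl_apply, Fintype.sum_prod_type]
  have h1 : ∀ x : A, ∑ χ : AddChar A Circle, ((χ (half x) : ℂ) * (χ (u - x) * f (u - x))) =
      (if x = u + u then (Fintype.card A : ℂ) else 0) * f (u - x) := by
    intro x
    have h2 : half x + (u - x) = 0 ↔ x = u + u := by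
      have h3 := two_nsmul_half hA x
      rw [two_nsmul] at h3
      constructor
      · intro h4
        have h5 : half x + half x + (u - x) + (u - x) = 0 := by
          rw [show half x + half x + (u - x) + (u - x) =
            (half x + (u - x)) + (half x + (u - x)) by abel, h4, add_zero]
        rw [h3] at h5
        have : x = u + u - (x + (u - x) + (u - x)) := by abel
        rw [this, h5, sub_zero]
      · intro h4
        have h5 : half x = u := by
          rw [h4, half_add, ← two_nsmul, two_nsmul_half hA]
        rw [h5, h4]; abel
    rw [← h2]
    have h6 := AddChar.sum_apply_eq_ite (half x + (u - x))
    rw [← h6, ← Equiv.sum_comp (AddChar.circleEquivComplex (α := A)).toEquiv, Finset.sum_mul]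
    refine Finset.sum_congr rfl fun χ _ => ?_
    rw [← mul_assoc]
    congr 1
    simp [AddChar.map_add_eq_mul, circleEquivComplex_apply]
  rw [Finset.sum_congr rfl fun x _ => h1 x]
  simp

/-! ### Operators that commute with the Weil representation -/

theorem weil_normWeyl (hA : Odd (Fintype.card A)) (α : AutKE A) (k : K A) (f : L2 A) :
    weil (autSection hA (.ofAdd α)) (normWeyl k f) =
      normWeyl (α.1 k) (weil (autSection hA (.ofAdd α)) f) := by
  have h := weil_spec (autSection hA (.ofAdd α)) (heisenbergEquiv (1, k))
  rw [autSection_normWeyl, coe_heisenbergEquiv, scalarOp_one, one_mul] at h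
  exact congrArg (fun T : U A => T f) h

/-- `X` commutes with all operators of the Weil representation of `Aut(K, e)`. -/
def CommutesWithWeil (hA : Odd (Fintype.card A)) (X : Module.End ℂ (L2 A)) : Prop :=
  ∀ (α : AutKE A) (f : L2 A),
    weil (autSection hA (.ofAdd α)) (X f) = X (weil (autSection hA (.ofAdd α)) f)

/-- Moving the Weil operator of `α` past the sum replaces `c` by `c ∘ α⁻¹`; independence allows
coefficients to be compared. -/
theorem commutesWithWeil_sum_iff (hA : Odd (Fintype.card A)) (c : K A → ℂ) :
    CommutesWithWeil hA (∑ k, c k • normWeylEnd k) ↔ ∀ (α : AutKE A) k, c (α.1 k) = c k := by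
  have h1 : ∀ (α : AutKE A) f, weil (autSection hA (.ofAdd α)) ((∑ k, c k • normWeylEnd k) f) =
      (∑ k, c (α.1.symm k) • normWeylEnd k) (weil (autSection hA (.ofAdd α)) f) := by
    intro α f
    rw [← Equiv.sum_comp α.1.toEquiv fun k => c (α.1.symm k) • normWeylEnd k]
    simp only [LinearMap.sum_apply, LinearMap.smul_apply, normWeylEnd_apply, map_sum, map_smul,
      weil_normWeyl]
    refine Finset.sum_congr rfl fun k _ => ?_
    change _ = c (α.1.symm (α.1 k)) • normWeyl (α.1 k) _
    rw [AddEquiv.symm_apply_apply]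
  constructor
  · intro h α k
    have h2 : ∑ k, (c (α.1.symm k) - c k) • normWeylEnd k = 0 := by
      simp only [sub_smul, Finset.sum_sub_distrib, sub_eq_zero]
      ext1 f
      obtain ⟨f, rfl⟩ := (weil (autSection hA (.ofAdd α))).surjective f
      rw [← h1, h]
    have h3 := Fintype.linearIndependent_iff.1 linearIndependent_normWeylEnd _ h2 (α.1 k)
    rw [AddEquiv.symm_apply_apply, sub_eq_zero] at h3
    exact h3.symm
  · intro h α f
    rw [h1]
    have h2 : ∀ k, c (α.1.symm k) = c k := fun k => by
      rw [← h α, AddEquiv.apply_symm_apply]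
    simp only [h2]

theorem commutesWithWeil_sum_normWeylEnd (hA : Odd (Fintype.card A)) :
    CommutesWithWeil hA (∑ k, normWeylEnd k) := by
  simpa using (commutesWithWeil_sum_iff hA fun _ => 1).2 fun _ _ => rfl

theorem weil_apply_neg (hA : Odd (Fintype.card A)) (α : AutKE A) {f g : L2 A}
    (h : ∀ u, g u = f (-u)) (u : A) :
    weil (autSection hA (.ofAdd α)) g u = weil (autSection hA (.ofAdd α)) f (-u) := by
  have h0 : (Fintype.card A : ℂ) ≠ 0 := Nat.cast_ne_zero.2 Fintype.card_ne_zero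
  have h1 : (∑ k : K A, normWeylEnd k) f = (Fintype.card A : ℂ) • g := by
    ext u
    rw [sum_normWeylEnd_apply hA, PiLp.smul_apply, h, smul_eq_mul]
  have h2 := commutesWithWeil_sum_normWeylEnd hA α f
  rw [h1, map_smul] at h2
  have h3 := congrArg (fun f : L2 A => f u) h2
  simp only [sum_normWeylEnd_apply hA, PiLp.smul_apply, smul_eq_mul] at h3
  exact mul_left_cancel₀ h0 h3

theorem weilInvariant_evenFunctions (hA : Odd (Fintype.card A)) :
    WeilInvariant hA (evenFunctions A) := fun α _ hf u =>
  (weil_apply_neg hA α (fun u => (hf u).symm) u).symm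

theorem weilInvariant_oddFunctions (hA : Odd (Fintype.card A)) :
    WeilInvariant hA (oddFunctions A) := fun α f hf u => by
  have h := weil_apply_neg hA α (f := f) (g := -f) (fun u => (hf u).symm) u
  rw [← h, map_neg]
  rfl

/-! ### The spaces of even and odd functions -/

theorem add_self_ne_zero (hA : Odd (Fintype.card A)) {a : A} (ha : a ≠ 0) : a + a ≠ 0 := by
  intro h
  apply ha
  rw [← two_nsmul_half hA a, half, ← mul_nsmul, mul_nsmul', two_nsmul a, h, smul_zero]

theorem evenFunctions_ne_bot : evenFunctions A ≠ ⊥ := by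
  rw [Submodule.ne_bot_iff]
  refine ⟨WithLp.toLp 2 fun _ => 1, fun u => rfl, fun h => ?_⟩
  have := congrArg (fun f : L2 A => f 0) h
  simp at this

theorem oddFunctions_ne_bot [Nontrivial A] (hA : Odd (Fintype.card A)) : oddFunctions A ≠ ⊥ := by
  classical
  obtain ⟨a, ha⟩ := exists_ne (0 : A)
  rw [Submodule.ne_bot_iff]
  refine ⟨EuclideanSpace.single a 1 - EuclideanSpace.single (-a) 1, fun u => ?_, fun h => ?_⟩
  · simp [neg_eq_iff_eq_neg]
  · have h1 : a ≠ -a := fun h => add_self_ne_zero hA ha (by rw [add_eq_zero_iff_eq_neg]; exact h)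
    have := congrArg (fun f : L2 A => f a) h
    simp [h1] at this

theorem oddFunctions_eq_bot [Subsingleton A] : oddFunctions A = ⊥ := by
  rw [eq_bot_iff]
  intro f hf
  rw [Submodule.mem_bot]
  ext u
  have := hf u
  rw [Subsingleton.elim (-u) u, eq_neg_iff_add_eq_zero, ← two_mul] at this
  simpa using this

theorem disjoint_even_odd : Disjoint (evenFunctions A) (oddFunctions A) := by
  rw [Submodule.disjoint_def]
  intro f h1 h2
  ext u
  have := h2 u
  rw [h1 u, eq_neg_iff_add_eq_zero, ← two_mul] at this
  simpa using this

/-- The even functions are proper, as they meet the non-zero space of odd functions only in 0. -/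
theorem not_weilIrreducible_top [Nontrivial A] (hA : Odd (Fintype.card A)) :
    ¬ WeilIrreducible hA (⊤ : Submodule ℂ (L2 A)) := by
  rintro ⟨-, -, h⟩
  rcases h _ le_top (weilInvariant_evenFunctions hA) with h | h
  · exact evenFunctions_ne_bot h
  · have := disjoint_even_odd (A := A)
    rw [h, top_disjoint] at this
    exact oddFunctions_ne_bot hA this

/-! ### The symplectic group of an elementary abelian group -/

theorem e_add_left (k k' l : K A) : e (k + k') l = e k l * e k' l := by
  simp only [e, Prod.fst_add, Prod.snd_add, AddChar.add_apply, AddChar.map_add_eq_mul, mul_inv]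
  exact mul_mul_mul_comm _ _ _ _

theorem e_swap (k l : K A) : e k l = (e l k)⁻¹ := by
  simp [e]

theorem e_self (k : K A) : e k k = 1 := by simp [e]

theorem e_zero_left (l : K A) : e 0 l = 1 := by simp [e]

theorem e_add_right (k l l' : K A) : e k (l + l') = e k l * e k l' := by
  rw [e_swap, e_add_left, mul_inv, ← e_swap, ← e_swap]

theorem exists_e_ne_one {k : K A} (hk : k ≠ 0) : ∃ l, e k l ≠ 1 := by
  obtain ⟨x, χ⟩ := k
  by_cases hx : x = 0
  · obtain ⟨y, hy⟩ : ∃ y, χ y ≠ 1 := by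
      by_contra! h
      exact hk (Prod.ext hx (DFunLike.ext χ 0 h))
    exact ⟨(y, 0), by simpa [e] using hy⟩
  · obtain ⟨ψ, hψ⟩ := AddChar.exists_apply_ne_zero.2 hx
    refine ⟨(0, AddChar.circleEquivComplex.symm ψ), fun h => hψ ?_⟩
    have h1 : AddChar.circleEquivComplex.symm ψ x = 1 := by simpa [e] using h
    rw [← AddChar.circleEquivComplex.apply_symm_apply ψ, circleEquivComplex_apply, h1,
      Circle.coe_one]

/-- A group is not the union of two proper subgroups, here the kernels of `e k` and `e l`: one of
`a`, `b`, `a + b` avoids both. -/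
theorem exists_e_ne_one_of_ne_zero {k l : K A} (hk : k ≠ 0) (hl : l ≠ 0) :
    ∃ m, e k m ≠ 1 ∧ e l m ≠ 1 := by
  obtain ⟨a, ha⟩ := exists_e_ne_one hk
  obtain ⟨b, hb⟩ := exists_e_ne_one hl
  by_cases h1 : e l a = 1
  · by_cases h2 : e k b = 1
    · exact ⟨a + b, by simpa [e_add_right, h2] using ha, by simpa [e_add_right, h1] using hb⟩
    · exact ⟨b, h2, hb⟩
  · exact ⟨a, ha, h1⟩

variable {p : ℕ} [Fact p.Prime]

theorem nsmul_K_eq_zero (hp : ∀ x : A, p • x = 0) (k : K A) : p • k = 0 := by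
  refine Prod.ext (hp _) (DFunLike.ext (p • k.2) 0 fun x => ?_)
  rw [AddChar.nsmul_apply, ← AddChar.map_nsmul_eq_pow, hp]
  simp

theorem exists_toCircle_eq {z : Circle} (hz : z ^ p = 1) : ∃ j : ZMod p, ZMod.toCircle j = z := by
  obtain ⟨j, hj⟩ := (bijective_rootsOfUnityAddChar p).2
    ⟨toUnits z, by rw [mem_rootsOfUnity, ← map_pow, hz, map_one]⟩
  exact ⟨j, congrArg (fun w => ((w : Circleˣ) : Circle)) (congrArg Subtype.val hj)⟩

theorem exists_toCircle_eq_e (hp : ∀ x : A, p • x = 0) (k l : K A) :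
    ∃ j : ZMod p, ZMod.toCircle j = e k l := by
  apply exists_toCircle_eq
  have h : ∀ n : ℕ, e (n • k) l = e k l ^ n := by
    intro n
    induction n with
    | zero => simp [e_zero_left]
    | succ n ih => rw [succ_nsmul, e_add_left, ih, pow_succ]
  rw [← h, nsmul_K_eq_zero hp, e_zero_left]

/-- The logarithm of `e` with values in `ZMod p`, for a group of exponent `p`. -/
def logE (hp : ∀ x : A, p • x = 0) (l : K A) : K A →+ ZMod p :=
  AddMonoidHom.mk' (fun k => (exists_toCircle_eq_e hp k l).choose) fun k k' =>
    ZMod.injective_toCircle <| by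
      rw [AddChar.map_add_eq_mul, (exists_toCircle_eq_e hp _ l).choose_spec,
        (exists_toCircle_eq_e hp _ l).choose_spec, (exists_toCircle_eq_e hp _ l).choose_spec,
        e_add_left]

theorem toCircle_logE (hp : ∀ x : A, p • x = 0) (k l : K A) :
    ZMod.toCircle (logE hp l k) = e k l :=
  (exists_toCircle_eq_e hp k l).choose_spec

theorem logE_swap (hp : ∀ x : A, p • x = 0) (k l : K A) : logE hp l k = -logE hp k l :=
  ZMod.injective_toCircle <| by
    rw [toCircle_logE, AddChar.map_neg_eq_inv, toCircle_logE, e_swap]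

theorem logE_self (hp : ∀ x : A, p • x = 0) (k : K A) : logE hp k k = 0 :=
  ZMod.injective_toCircle <| by rw [toCircle_logE, AddChar.map_zero_eq_one, e_self]

theorem logE_add_left (hp : ∀ x : A, p • x = 0) (k l l' : K A) :
    logE hp (l + l') k = logE hp l k + logE hp l' k := by
  rw [logE_swap, map_add, neg_add, ← logE_swap, ← logE_swap]

/-- The formula uses the natural-number multiple by `(f x).val`, so that it makes sense on `K`
without reference to its `ZMod p`-module structure. -/
theorem exists_transvection {V : Type*} [AddCommGroup V] [Module (ZMod p) V] (f : V →+ ZMod p)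
    {v : V} (hv : f v = 0) : ∃ α : AddAut V, ∀ x, α x = x + (f x).val • v := by
  have h : (f.toZModLinearMap p) v = 0 := hv
  refine ⟨(LinearEquiv.transvection h).toAddEquiv, fun x => ?_⟩
  rw [← Nat.cast_smul_eq_nsmul (ZMod p), ZMod.natCast_zmod_val]
  rfl

/-- A symplectic transvection takes `k` to `l` when `e k l ≠ 1`. -/
theorem exists_autKE_apply_eq_of_e_ne_one (hp : ∀ x : A, p • x = 0) {k l : K A}
    (h : e k l ≠ 1) : ∃ α : AutKE A, α.1 k = l := by
  have hkl : logE hp l k ≠ 0 := fun h0 =>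
    h (by rw [← toCircle_logE hp, h0, AddChar.map_zero_eq_one])
  -- The transvection `a ↦ a + t · logE (l - k) a • (l - k)` sends `k` to `l` for this `t`, since
  -- `logE (l - k) k = logE l k`.
  set t : ZMod p := (logE hp l k)⁻¹ with ht
  have hr : ∀ (r : ZMod p) (a b : K A), logE hp a (r.val • b) = r * logE hp a b := fun r a b => by
    rw [map_nsmul, nsmul_eq_mul, ZMod.natCast_zmod_val]
  have hl : ∀ (r : ZMod p) (a b : K A), logE hp (r.val • a) b = r * logE hp a b := fun r a b => by
    rw [logE_swap, hr, logE_swap hp a, mul_neg, neg_neg]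
  obtain ⟨α, hα⟩ := @exists_transvection p _ _ _ (AddCommGroup.zmodModule (nsmul_K_eq_zero hp))
    ((AddMonoidHom.mulLeft t).comp (logE hp (l - k))) (v := l - k) (by simp [logE_self])
  simp only [AddMonoidHom.comp_apply, AddMonoidHom.coe_mulLeft] at hα
  refine ⟨⟨α, fun a b => ?_⟩, ?_⟩
  · rw [← toCircle_logE hp, ← toCircle_logE hp, hα, hα]
    congr 1
    -- The quadratic term vanishes because the form is alternating; the two linear terms cancel by
    -- antisymmetry.
    simp only [map_add, hr, hl, logE_add_left, logE_self]
    rw [logE_swap hp (l - k) b]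
    ring
  · have h1 : logE hp (l - k) k = logE hp l k := by
      have := logE_add_left hp k (l - k) k
      rw [sub_add_cancel, logE_self, add_zero] at this
      exact this.symm
    rw [hα, h1, ht, inv_mul_cancel₀ hkl, ZMod.val_one, one_smul, add_sub_cancel]

/-- One transvection may not suffice when `e k l = 1`, so two are composed through an `m` that pairs
non-trivially with both. -/
theorem exists_autKE_apply_eq (hp : ∀ x : A, p • x = 0) {k l : K A} (hk : k ≠ 0) (hl : l ≠ 0) :
    ∃ α : AutKE A, α.1 k = l := by
  obtain ⟨m, hkm, hlm⟩ := exists_e_ne_one_of_ne_zero hk hl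
  have hml : e m l ≠ 1 := by rwa [e_swap, inv_ne_one]
  obtain ⟨α, hα⟩ := exists_autKE_apply_eq_of_e_ne_one hp hkm
  obtain ⟨β, hβ⟩ := exists_autKE_apply_eq_of_e_ne_one hp hml
  exact ⟨β + α, by rw [← hβ, ← hα]; rfl⟩

/-! ### Irreducibility for prime exponent -/

/-- By dimension a Weil operator maps `V` onto itself, and conjugating a projection by a unitary
operator gives the projection onto the image. -/
theorem WeilInvariant.commutesWithWeil_starProjection {hA : Odd (Fintype.card A)}
    {V : Submodule ℂ (L2 A)} (hV : WeilInvariant hA V) :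
    CommutesWithWeil hA V.starProjection.toLinearMap := by
  intro α f
  set W := weil (autSection hA (.ofAdd α))
  have h1 : V.map (W.toLinearEquiv : L2 A →ₗ[ℂ] L2 A) = V := by
    apply Submodule.eq_of_le_of_finrank_eq
    · rintro _ ⟨f, hf, rfl⟩
      exact hV α f hf
    · exact LinearEquiv.finrank_map_eq _ _
  have h2 := Submodule.starProjection_map_apply W V (W f)
  rw [LinearIsometryEquiv.symm_apply_apply] at h2
  simp only [h1] at h2
  exact h2.symm

theorem CommutesWithWeil.exists_eq_add (hp : ∀ x : A, p • x = 0) {hA : Odd (Fintype.card A)}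
    {X : Module.End ℂ (L2 A)} (hX : CommutesWithWeil hA X) :
    ∃ a b : ℂ, ∀ f u, X f u = a * f u + b * f (-u) := by
  classical
  obtain ⟨c, rfl⟩ := exists_eq_sum_normWeylEnd X
  rw [commutesWithWeil_sum_iff] at hX
  obtain ⟨b, hb⟩ : ∃ b, ∀ k, k ≠ 0 → c k = b := by
    by_cases h : ∃ k : K A, k ≠ 0
    · obtain ⟨k, hk⟩ := h
      refine ⟨c k, fun l hl => ?_⟩
      obtain ⟨α, rfl⟩ := exists_autKE_apply_eq hp hk hl
      exact hX α k
    -- If `K` is trivial there is no condition on `b`, and any value serves.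
    · exact ⟨0, fun k hk => (h ⟨k, hk⟩).elim⟩
  refine ⟨c 0 - b, b * Fintype.card A, fun f u => ?_⟩
  have h1 : ∑ k, c k • normWeylEnd k =
      (c 0 - b) • normWeylEnd (0 : K A) + b • ∑ k : K A, normWeylEnd k := by
    rw [Finset.smul_sum, ← Finset.add_sum_erase _ _ (Finset.mem_univ 0),
      ← Finset.add_sum_erase Finset.univ (fun k => b • normWeylEnd k) (Finset.mem_univ 0),
      ← add_assoc, ← add_smul, sub_add_cancel]
    congr 1
    exact Finset.sum_congr rfl fun k hk => by rw [hb k (Finset.ne_of_mem_erase hk)]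
  rw [h1, LinearMap.add_apply, PiLp.add_apply, LinearMap.smul_apply, LinearMap.smul_apply,
    PiLp.smul_apply, PiLp.smul_apply, sum_normWeylEnd_apply hA, normWeylEnd_apply, normWeyl_zero]
  simp [mul_assoc]

/-- The projection fixes `V'`, so `c = 0` forces `V' = 0`; otherwise each `f` in `V` is a multiple
of its projection and lies in `V'`. -/
theorem eq_bot_or_eq_of_starProjection_smul {V V' : Submodule ℂ (L2 A)} (hle : V' ≤ V) {c : ℂ}
    (h : ∀ f ∈ V, V'.starProjection f = c • f) : V' = ⊥ ∨ V' = V := by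
  by_cases hc : c = 0
  · left
    rw [eq_bot_iff]
    intro f hf
    have := h f (hle hf)
    rw [Submodule.starProjection_eq_self_iff.2 hf, hc, zero_smul] at this
    exact this
  · right
    refine le_antisymm hle fun f hf => ?_
    have h1 := Submodule.starProjection_apply_mem V' f
    rw [h f hf] at h1
    exact (V'.smul_mem_iff hc).1 h1

theorem weilIrreducible_evenFunctions (hp : ∀ x : A, p • x = 0) (hA : Odd (Fintype.card A)) :
    WeilIrreducible hA (evenFunctions A) := by
  refine ⟨weilInvariant_evenFunctions hA, evenFunctions_ne_bot, fun V' hle hV' => ?_⟩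
  obtain ⟨a, b, hab⟩ := hV'.commutesWithWeil_starProjection.exists_eq_add hp
  refine eq_bot_or_eq_of_starProjection_smul (c := a + b) hle fun f hf => ?_
  ext u
  have h1 := hab f u
  rw [hf u, ← add_mul] at h1
  exact h1

theorem weilIrreducible_oddFunctions [Nontrivial A] (hp : ∀ x : A, p • x = 0)
    (hA : Odd (Fintype.card A)) : WeilIrreducible hA (oddFunctions A) := by
  refine ⟨weilInvariant_oddFunctions hA, oddFunctions_ne_bot hA, fun V' hle hV' => ?_⟩
  obtain ⟨a, b, hab⟩ := hV'.commutesWithWeil_starProjection.exists_eq_add hp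
  refine eq_bot_or_eq_of_starProjection_smul (c := a - b) hle fun f hf => ?_
  ext u
  have h1 := hab f u
  rw [hf u, mul_neg, ← sub_eq_add_neg, ← sub_mul] at h1
  exact h1

/-! ### Reducibility for composite exponent -/

/-- Schur's lemma: `X` has an eigenvector in `V`, and the eigenspace within `V` is invariant. -/
theorem CommutesWithWeil.exists_eq_smul {hA : Odd (Fintype.card A)} {X : Module.End ℂ (L2 A)}
    (hX : CommutesWithWeil hA X) {V : Submodule ℂ (L2 A)} (hV : WeilIrreducible hA V)
    (hXV : ∀ f ∈ V, X f ∈ V) : ∃ c : ℂ, ∀ f ∈ V, X f = c • f := by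
  obtain ⟨hinv, hne, hirr⟩ := hV
  have := Submodule.nontrivial_iff_ne_bot.2 hne
  obtain ⟨c, hc⟩ := Module.End.exists_eigenvalue (X.restrict hXV)
  obtain ⟨v, hv, hv0⟩ := hc.exists_hasEigenvector
  rw [Module.End.mem_eigenspace_iff] at hv
  have h1 : X v = c • (v : L2 A) := congrArg Subtype.val hv
  refine ⟨c, ?_⟩
  rcases hirr (V ⊓ Module.End.eigenspace X c) inf_le_left (by
    rintro α f ⟨hf, hf'⟩
    refine ⟨hinv α f hf, ?_⟩
    rw [SetLike.mem_coe, Module.End.mem_eigenspace_iff] at hf' ⊢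
    rw [← hX, hf', map_smul]) with h | h
  · have h2 : (v : L2 A) ∈ V ⊓ Module.End.eigenspace X c :=
      ⟨v.2, Module.End.mem_eigenspace_iff.2 h1⟩
    rw [h, Submodule.mem_bot] at h2
    exact (hv0 (Subtype.ext h2)).elim
  · intro f hf
    rw [← h] at hf
    exact Module.End.mem_eigenspace_iff.1 hf.2

theorem normWeyl_neg_apply (k : K A) {f g : L2 A} (h : ∀ u, g u = f (-u)) (u : A) :
    normWeyl (-k) g u = normWeyl k f (-u) := by
  simp only [normWeyl_apply, Prod.fst_neg, Prod.snd_neg, half_neg, AddChar.neg_apply, h]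
  rw [neg_neg, show -(u - -k.1) = -u - k.1 by abel]

/-- The automorphism `-1` of `K`. -/
def negAutKE : AutKE A :=
  ⟨AddEquiv.neg (K A), fun k l => by simp [e, AddChar.map_neg_eq_inv]⟩

/-- If the even and the odd functions form irreducible subspaces, then a function on `K` that is
invariant under `Aut(K, e)` is constant outside `0`. -/
theorem eq_of_weilIrreducible {hA : Odd (Fintype.card A)}
    (heven : WeilIrreducible hA (evenFunctions A)) (hodd : WeilIrreducible hA (oddFunctions A))
    {c : K A → ℂ} (hc : ∀ (α : AutKE A) k, c (α.1 k) = c k) {k l : K A} (hk : k ≠ 0) (hl : l ≠ 0) :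
    c k = c l := by
  classical
  set X : Module.End ℂ (L2 A) := ∑ k, c k • normWeylEnd k with hXdef
  have hX := (commutesWithWeil_sum_iff hA c).2 hc
  rw [← hXdef] at hX
  have h0 : (Fintype.card A : ℂ) ≠ 0 := Nat.cast_ne_zero.2 Fintype.card_ne_zero
  -- Since `-1` belongs to `Aut(K, e)`, `c` is even; hence `X` commutes with the reflection and
  -- preserves parity.
  have hneg : ∀ f g : L2 A, (∀ u, g u = f (-u)) → ∀ u, X g u = X f (-u) := by
    intro f g h u
    simp only [hXdef, LinearMap.sum_apply, LinearMap.smul_apply, normWeylEnd_apply,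
      WithLp.ofLp_sum, Finset.sum_apply, PiLp.smul_apply]
    rw [← Equiv.sum_comp (Equiv.neg (K A))]
    refine Finset.sum_congr rfl fun k _ => ?_
    rw [Equiv.neg_apply, normWeyl_neg_apply k h, show c (-k) = c k from hc negAutKE k]
  obtain ⟨a, ha⟩ := hX.exists_eq_smul heven fun f hf u => (hneg f f (fun u => (hf u).symm) u).symm
  obtain ⟨b, hb⟩ := hX.exists_eq_smul hodd fun f hf u => by
    rw [← hneg f (-f) (fun u => (hf u).symm) u, map_neg, PiLp.neg_apply]
  -- With scalars `a` on even and `b` on odd functions, `X` is `(a + b) / 2` plus `(a - b) / 2`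
  -- times the reflection, and the reflection is the sum of all `normWeylEnd k` divided by `|A|`.
  have h1 : X = ((a + b) / 2) • normWeylEnd (0 : K A) +
      ((a - b) / 2 / Fintype.card A) • ∑ k : K A, normWeylEnd k := by
    ext f u
    let g : L2 A := WithLp.toLp 2 fun u => f (-u)
    have hg : ∀ u, g u = f (-u) := fun u => rfl
    have h2 := ha (f + g) fun u => by simp [hg, add_comm]
    have h3 := hb (f - g) fun u => by simp [hg]
    rw [map_add] at h2
    rw [map_sub] at h3
    replace h2 := congrArg (fun f : L2 A => f u) h2
    replace h3 := congrArg (fun f : L2 A => f u) h3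
    simp only [PiLp.add_apply, PiLp.sub_apply, PiLp.smul_apply, smul_eq_mul, hg] at h2 h3
    rw [LinearMap.add_apply, LinearMap.smul_apply, LinearMap.smul_apply, PiLp.add_apply,
      PiLp.smul_apply, PiLp.smul_apply, sum_normWeylEnd_apply hA, normWeylEnd_apply, normWeyl_zero,
      smul_eq_mul, smul_eq_mul, ← mul_assoc, div_mul_cancel₀ _ h0]
    change X f u = (a + b) / 2 * f u + _
    linear_combination (h2 + h3) / 2
  have h2 : ∑ k : K A, (c k - (if k = 0 then (a + b) / 2 else 0) -
      (a - b) / 2 / Fintype.card A) • normWeylEnd k = 0 := by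
    simp only [sub_smul, Finset.sum_sub_distrib, ← Finset.smul_sum, ite_smul, zero_smul]
    rw [← hXdef, h1]
    simp
  have h3 : ∀ k, k ≠ 0 → c k = (a - b) / 2 / Fintype.card A := fun k hk => by
    have := Fintype.linearIndependent_iff.1 linearIndependent_normWeylEnd _ h2 k
    rwa [if_neg hk, sub_zero, sub_eq_zero] at this
  rw [h3 k hk, h3 l hl]

theorem nontrivial_of_weilIrreducible {hA : Odd (Fintype.card A)}
    (hodd : WeilIrreducible hA (oddFunctions A)) : Nontrivial A := by
  by_contra h
  rw [not_nontrivial_iff_subsingleton] at h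
  exact hodd.2.1 oddFunctions_eq_bot

theorem exponent_prime_of_weilIrreducible {hA : Odd (Fintype.card A)}
    (heven : WeilIrreducible hA (evenFunctions A)) (hodd : WeilIrreducible hA (oddFunctions A)) :
    (AddMonoid.exponent A).Prime := by
  classical
  have := nontrivial_of_weilIrreducible hodd
  have hcard : Fintype.card A ≠ 1 := Fintype.one_lt_card.ne'
  set p := (Fintype.card A).minFac
  have hp : p.Prime := Nat.minFac_prime hcard
  have : Fact p.Prime := ⟨hp⟩
  obtain ⟨x, hx⟩ := exists_prime_addOrderOf_dvd_card p (Nat.minFac_dvd (Fintype.card A))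
  have hx0 : x ≠ 0 := by
    rintro rfl
    rw [addOrderOf_zero] at hx
    exact hp.one_lt.ne hx
  have hpx : p • x = 0 := hx ▸ addOrderOf_nsmul_eq_zero x
  have hall : ∀ y : A, p • y = 0 := by
    intro y
    by_contra hy
    have hy0 : y ≠ 0 := by
      rintro rfl
      exact hy (smul_zero p)
    -- Automorphisms preserve `p`-torsion, so its indicator is invariant; yet it would be 1 at `(x,
    -- 0)` and 0 at `(y, 0)`.
    have h := eq_of_weilIrreducible heven hodd (c := fun k => if p • k = 0 then 1 else 0)
      (fun α k => by simp only [← map_nsmul, EmbeddingLike.map_eq_zero_iff])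
      (k := (x, 0)) (l := (y, 0)) (fun h => hx0 (congrArg Prod.fst h))
      (fun h => hy0 (congrArg Prod.fst h))
    simp [Prod.ext_iff, hpx, hy] at h
  rcases (Nat.dvd_prime hp).1 (AddMonoid.exponent_dvd_of_forall_nsmul_eq_zero hall) with h | h
  · rw [AddMonoid.exp_eq_one_iff] at h
    exact (not_subsingleton A h).elim
  · rwa [h]

theorem weilIrreducible_iff (hA : Odd (Fintype.card A)) :
    WeilIrreducible hA (evenFunctions A) ∧ WeilIrreducible hA (oddFunctions A) ↔
      (AddMonoid.exponent A).Prime := by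
  refine ⟨fun h => exponent_prime_of_weilIrreducible h.1 h.2, fun h => ?_⟩
  have : Fact (AddMonoid.exponent A).Prime := ⟨h⟩
  -- The trivial group, whose odd functions are all zero, has exponent 1 and is thereby excluded.
  have : Nontrivial A := by
    by_contra h1
    rw [not_nontrivial_iff_subsingleton, ← AddMonoid.exp_eq_one_iff] at h1
    exact h.ne_one h1
  have hp : ∀ x : A, AddMonoid.exponent A • x = 0 := AddMonoid.exponent_nsmul_eq_zero
  exact ⟨weilIrreducible_evenFunctions hp hA, weilIrreducible_oddFunctions hp hA⟩

end FiniteWeil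

end

theorem mainTheorem9 {A : Type*} [AddCommGroup A] [Fintype A] (hA : Odd (Fintype.card A)) :
    (Nontrivial A → ¬ FiniteWeil.WeilIrreducible hA (⊤ : Submodule ℂ (FiniteWeil.L2 A))) ∧
    FiniteWeil.WeilInvariant hA (FiniteWeil.evenFunctions A) ∧
    FiniteWeil.WeilInvariant hA (FiniteWeil.oddFunctions A) ∧
    ((FiniteWeil.WeilIrreducible hA (FiniteWeil.evenFunctions A) ∧
        FiniteWeil.WeilIrreducible hA (FiniteWeil.oddFunctions A)) ↔
      (AddMonoid.exponent A).Prime) :=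
  ⟨fun _ => FiniteWeil.not_weilIrreducible_top hA, FiniteWeil.weilInvariant_evenFunctions hA,
    FiniteWeil.weilInvariant_oddFunctions hA, FiniteWeil.weilIrreducible_iff hA⟩
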